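/- **Setting.** Let $\mathcal H$ be a class of (measurable) functions $X\to\{0,1\}$ with VC-dimension $d\in\mathbb N\cup\{\infty\}$. For a target $f\in\mathcal H$ let $D^+$ and $D^-$ be probability distributions on the positive and on the negative examples of $f$. The oracles $\mathrm{Pos}^\lambda$, $\mathrm{Neg}^\lambda$ with outlier rate $\lambda$ return, independently at each call, with probability $1-\lambda$ an example drawn from $D^+$ (resp. $D^-$), and with probability $\lambda$ an arbitrary example chosen by an adversary who knows everything that has happened so far. A fixed finite number of examples is obtained from the oracles and is distributed in some way over two machines $M_1,M_2$. In a *$t$-round two-machine protocol* with public randomness the machines send $t$ messages in turn (either machine may start), the $i$-th message having $\ell_i$ bits and depending on the public coins, the sender's examples and the earlier messages; the recipient of the last message announces a hypothesis $h\in\mathcal H$. Its cost is $\ell_1+\dots+\ell_t$. The protocol *learns $\mathcal H$ to error $\epsilon$ with failure probability $\delta$* if for every target $f\in\mathcal H$, all $D^+,D^-$, every adversary and every distribution of the examples over the two machines, with probability at least $1-\delta$ the errors $D^+(h=0)$ and $D^-(h=1)$ are both less than $\epsilon$. Let $R^{M_1\leftrightarrow M_2}_{\epsilon}(\mathcal H)$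 be the least cost of a $t$-round protocol that does so ($\infty$ if there is none). **Theorem.** For all $\epsilon_0<\tfrac12$ and $0<\delta<1$ there are a constant $c>0$ and a $d_0\in\mathbb N$, depending only on $\epsilon_0$ and $\delta$, with $d_0\le 2$ if $\delta<\tfrac12$, such that for every class $\mathcal H$ with VC-dimension $d\ge d_0$, every error rate $\epsilon\le\epsilon_0$, every outlier rate $0\le\lambda<\epsilon$ and every $t\ge1$, $$R^{M_1\leftrightarrow M_2}_{\epsilon}(\mathcal H)\;\ge\; c\,\frac{1-\epsilon}{1-\lambda}\cdot\frac{d}{t^2}.$$ -/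

import Mathlib

open MeasureTheory
open scoped ENNReal

namespace RobustLearning

/-! ### VC-dimension -/

/-- The class `H` shatters the finite set `S`: every labelling of `S` is realised by a member
of `H`. -/
def Shatters {X : Type*} (H : Set (X → Bool)) (S : Finset X) : Prop :=
  ∀ g : X → Bool, ∃ h ∈ H, ∀ x ∈ S, h x = g x

/-- The VC-dimension of `H`: the supremum (possibly `⊤`) of the sizes of the finite sets that
`H` shatters. -/
noncomputable def vcDim {X : Type*} (H : Set (X → Bool)) : ℕ∞ :=
  ⨆ S : Finset X, ⨆ _ : Shatters H S, (S.card : ℕ∞)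

/-! ### The noisy oracles -/

/-- The law of the corruption flag of one oracle call: `true` (the call is corrupted) with
probability `lam`, and `false` with probability `1 - lam`. -/
noncomputable def flagLaw (lam : ℝ) : Measure Bool :=
  ENNReal.ofReal (1 - lam) • Measure.dirac false + ENNReal.ofReal lam • Measure.dirac true

/-- The law of the latent data of `m` independent oracle calls. Call `i` goes to the positive
oracle if `oracle i = true` and to the negative one if `oracle i = false`; its latent data are a
corruption flag and, independently of it, a clean example from the target distribution
`D (oracle i)`. -/
noncomputable def callLaw {X : Type*} [MeasurableSpace X] (lam : ℝ) (D : Bool → Measure X)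
    {m : ℕ} (oracle : Fin m → Bool) : Measure (Fin m → Bool × X) :=
  Measure.pi fun i => (flagLaw lam).prod (D (oracle i))

/-- A malicious adversary for `m` oracle calls. If call `i` is corrupted, it replaces the answer by
an example of its choice, which may depend on everything that has happened up to call `i`. -/
structure Adversary (X : Type*) [MeasurableSpace X] (m : ℕ) where
  /-- the example substituted in call `i`, given the latent data of the calls up to `i` -/
  choose : (i : Fin m) → (Set.Iic i → Bool × X) → X
  measurable_choose : ∀ i, Measurable (choose i)

/-- The examples that the noisy oracles return: the clean example where the flag is `false`, the
example chosen by the adversary where it is `true`. -/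
def Adversary.sample {X : Type*} [MeasurableSpace X] {m : ℕ} (A : Adversary X m)
    (z : Fin m → Bool × X) (i : Fin m) : X :=
  if (z i).1 then A.choose i (fun j => z j) else (z i).2

/-! ### Two-machine protocols -/

/-- The two machines. -/
inductive Machine
  | one
  | two
  deriving DecidableEq

/-- The other machine. -/
def Machine.other : Machine → Machine
  | .one => .two
  | .two => .one

/-- The part of the sample `x` that machine `M` holds, if example `i` is stored on machine
`place i`. -/
def localData {X : Type*} {m : ℕ} (place : Fin m → Machine) (x : Fin m → X) (M : Machine) :
    Fin m → Option X :=
  fun i => if place i = M then some (x i) else none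

/-- A public-coin two-machine protocol for learning with hypotheses from `H`. The number of rounds
is not part of the data: a `t`-round protocol uses the messages number `0, …, t - 1`. -/
structure Protocol {X : Type*} (H : Set (X → Bool)) where
  /-- number of oracle calls, that is, of training examples -/
  m : ℕ
  /-- which oracle (`true` positive, `false` negative) call `i` goes to -/
  oracle : Fin m → Bool
  /-- the public coins -/
  Coins : Type
  [measurableSpace : MeasurableSpace Coins]
  coinLaw : Measure Coins
  [isProbabilityMeasure : IsProbabilityMeasure coinLaw]
  /-- the machine that sends the first message -/
  first : Machine
  /-- the number of bits of message `i` -/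
  len : ℕ → ℕ
  /-- message `i`, computed by its sender from the public coins, the sender's part of the sample
  and the bits of the earlier messages -/
  msg : (i : ℕ) → Coins → (Fin m → Option X) → List Bool → (Fin (len i) → Bool)
  /-- the hypothesis announced, computed by the announcing machine from the public coins, its part
  of the sample and all the bits exchanged -/
  announce : Coins → (Fin m → Option X) → List Bool → H

namespace Protocol

attribute [instance] Protocol.measurableSpace Protocol.isProbabilityMeasure

variable {X : Type*} {H : Set (X → Bool)}

/-- The machine that sends message `i`; the machines speak in turn. -/
def speaker (P : Protocol H) : ℕ → Machine
  | 0 => P.first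
  | i + 1 => (P.speaker i).other

/-- The bits exchanged in the first `i` rounds, if machine `M` holds the data `v M`. -/
def transcript (P : Protocol H) (c : P.Coins) (v : Machine → Fin P.m → Option X) : ℕ → List Bool
  | 0 => []
  | i + 1 => P.transcript c v i ++
      List.ofFn (P.msg i c (v (P.speaker i)) (P.transcript c v i))

/-- The hypothesis learned in `t` rounds. It is announced by the recipient of the last message,
which is the machine whose turn it would be next. -/
def output (P : Protocol H) (t : ℕ) (c : P.Coins) (v : Machine → Fin P.m → Option X) : X → Bool :=
  P.announce c (v (P.speaker t)) (P.transcript c v t)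

/-- The number of bits exchanged in `t` rounds. -/
def cost (P : Protocol H) (t : ℕ) : ℕ := ∑ i ∈ Finset.range t, P.len i

/-- Robust PAC learning of `H` in `t` rounds, with error less than `ε`, failure probability at most
`δ` and outlier rate `lam`: whatever the target `f` in `H`, the target distributions `D true` and
`D false` on its positive and negative examples, the adversary, and the way in which the training
examples are distributed over the two machines, with probability at least `1 - δ` over public coins
and oracle calls, both the error on positive examples and the error on negative examples of the
learned hypothesis are less than `ε`.

Failure is measured by the outer measure of the set of bad outcomes, so a protocol whose messages
are not measurable gains nothing. -/
def Learns [MeasurableSpace X] (P : Protocol H) (t : ℕ) (ε δ lam : ℝ) : Prop :=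
  ∀ f ∈ H, ∀ D : Bool → Measure X, (∀ b, IsProbabilityMeasure (D b)) →
    (∀ b, D b {x | f x = b} = 1) →
    ∀ A : Adversary X P.m, ∀ place : Fin P.m → Machine,
      (P.coinLaw.prod (callLaw lam D P.oracle))
        {ω | ¬ ∀ b, D b {x | P.output t ω.1 (localData place (A.sample ω.2)) x ≠ b}
              < ENNReal.ofReal ε} ≤ ENNReal.ofReal δ

end Protocol

/-- The communication complexity of learning `H` by `t`-round two-machine protocols (started by
either machine): the least number of bits exchanged by such a protocol, `⊤` if there is none. -/
noncomputable def commComplexity {X : Type*} [MeasurableSpace X] (H : Set (X → Bool)) (t : ℕ)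
    (ε δ lam : ℝ) : ℕ∞ :=
  ⨅ P : Protocol H, ⨅ _ : P.Learns t ε δ lam, (P.cost t : ℕ∞)

end RobustLearning

open MeasureTheory
open scoped ENNReal

namespace RobustLearning

/-! ### Averaging over the public coins -/

/-! All examples are stored on the machine that does not announce the hypothesis. The announcer then
knows only the coins and `cost` bits, so for fixed coins at most `2 ^ cost` hypotheses can occur.
Cut a shattered set into `k` pairs; each of the `2 ^ k` sign vectors gives a target with one
positive and one negative point per pair, and the examples are uniform on these. A hypothesis with
both errors below `ε` mislabels fewer than `2 ε k` of the `2 k` points, while the average over signs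
is `k`, so by Chernoff it suits an exponentially small fraction of the targets. Averaging over the
coins yields `(1 - δ) * 2 ^ k ≤ 2 ^ cost * V` (`Protocol.Learns.mul_two_pow_le`), hence a cost
linear in `k`. The factors `(1 - ε) / (1 - lam)` and `1 / t ^ 2` are at most one and only weaken
this bound. -/

/-- If each of finitely many events has outer measure at most `δ`, and every outcome avoids at most
`B` of them, then there are at most `B / (1 - δ)` events. -/
lemma card_mul_le_of_measure_le {Ω I : Type*} [MeasurableSpace Ω] [Fintype I] (μ : Measure Ω)
    [IsProbabilityMeasure μ] (U : I → Set Ω) (δ : ℝ) (hδ : 0 ≤ δ) (B : ℝ) (hB : 0 ≤ B)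
    (hU : ∀ i, μ (U i) ≤ ENNReal.ofReal δ)
    (hcard : ∀ c, (Nat.card {i // c ∉ U i} : ℝ) ≤ B) :
    (1 - δ) * Fintype.card I ≤ B := by
  classical
  -- The events need not be measurable; their measurable hulls have the same measure and can be
  -- integrated.
  have hpt : ∀ c, (Fintype.card I : ℝ≥0∞) ≤
      ENNReal.ofReal B + ∑ i, (toMeasurable μ (U i)).indicator 1 c := by
    intro c
    have h1 : (Fintype.card I : ℝ≥0∞) =
        ∑ i, (U i)ᶜ.indicator (1 : Ω → ℝ≥0∞) c + ∑ i, (U i).indicator 1 c := by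
      rw [← Finset.sum_add_distrib]
      have : ∀ i, (U i)ᶜ.indicator (1 : Ω → ℝ≥0∞) c + (U i).indicator 1 c = 1 := by
        intro i
        by_cases h : c ∈ U i <;> simp [h]
      simp [this]
    have h2 : ∑ i, (U i)ᶜ.indicator (1 : Ω → ℝ≥0∞) c ≤ ENNReal.ofReal B := by
      have : ∑ i, (U i)ᶜ.indicator (1 : Ω → ℝ≥0∞) c = (Nat.card {i // c ∉ U i} : ℝ≥0∞) := by
        simp [Set.indicator_apply, Finset.sum_ite, Fintype.card_subtype]
      rw [this, ← ENNReal.ofReal_natCast]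
      exact ENNReal.ofReal_le_ofReal (hcard c)
    rw [h1]
    gcongr with i
    exact subset_toMeasurable μ (U i)
  have hint : (Fintype.card I : ℝ≥0∞) ≤
      ENNReal.ofReal B + Fintype.card I * ENNReal.ofReal δ := by
    calc (Fintype.card I : ℝ≥0∞) = ∫⁻ _, (Fintype.card I : ℝ≥0∞) ∂μ := by simp
      _ ≤ ∫⁻ c, (ENNReal.ofReal B + ∑ i, (toMeasurable μ (U i)).indicator 1 c) ∂μ :=
          lintegral_mono hpt
      _ = ENNReal.ofReal B + ∑ i, μ (U i) := by
          rw [lintegral_add_left measurable_const, lintegral_finsetSum]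
          · simp
          · exact fun i _ => measurable_one.indicator (measurableSet_toMeasurable _ _)
      _ ≤ ENNReal.ofReal B + ∑ _i : I, ENNReal.ofReal δ := by
          gcongr with i
          exact hU i
      _ = _ := by simp
  rw [← ENNReal.ofReal_natCast, ← ENNReal.ofReal_mul (by positivity),
    ← ENNReal.ofReal_add hB (by positivity), ENNReal.ofReal_le_ofReal_iff (by positivity)] at hint
  linarith

/-! ### Counting the targets for which one hypothesis is good -/

/-- A Chernoff bound: if the two values of each of `k` weights add up to `2`, few of the `2 ^ k`
choices have a total weight below `2 ε k`. -/
lemma card_sum_lt_le {k : ℕ} (w : Fin k → Bool → ℕ) (hw : ∀ i, w i true + w i false = 2) (ε : ℝ)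
    (hε : ε < 1 / 2) :
    (Nat.card {s : Fin k → Bool // (∑ i, w i (s i) : ℝ) < 2 * ε * k} : ℝ) ≤
      2 ^ k * Real.exp (-((1 - 2 * ε) ^ 2 / 2 * k)) := by
  classical
  -- The deviation from the mean `k` exceeds `g * k`. As `cosh x ≤ exp (x ^ 2 / 2)`, the best
  -- exponential parameter is `g` itself.
  set g : ℝ := 1 - 2 * ε with hg
  have hg0 : 0 < g := by linarith
  have hterm : ∀ i, ∑ b : Bool, Real.exp (g * (1 - w i b)) ≤ 2 * Real.cosh g := by
    intro i
    have h2 : ((w i true : ℝ)) + w i false = 2 := by exact_mod_cast hw i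
    have hcases : w i true = 0 ∨ w i true = 1 ∨ w i true = 2 := by have := hw i; omega
    rw [Fintype.sum_bool]
    rcases hcases with h | h | h
    · have h' : (w i false : ℝ) = 2 := by rw [h] at h2; simpa using h2
      rw [h', h, Real.cosh_eq]; norm_num; linarith
    · have h' : (w i false : ℝ) = 1 := by rw [h] at h2; push_cast at h2; linarith
      rw [h', h]; have := Real.one_le_cosh g; norm_num
    · have h' : (w i false : ℝ) = 0 := by rw [h] at h2; push_cast at h2; linarith
      rw [h', h, Real.cosh_eq]; norm_num; linarith
  have htotal : ∑ s : Fin k → Bool, Real.exp (g * (k - ∑ i, (w i (s i) : ℝ))) ≤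
      (2 * Real.cosh g) ^ k := by
    calc ∑ s : Fin k → Bool, Real.exp (g * (k - ∑ i, (w i (s i) : ℝ)))
        = ∑ s : Fin k → Bool, ∏ i, Real.exp (g * (1 - w i (s i))) := by
          refine Finset.sum_congr rfl fun s _ => ?_
          rw [← Real.exp_sum, ← Finset.mul_sum, Finset.sum_sub_distrib]
          simp
      _ = ∏ i, ∑ b : Bool, Real.exp (g * (1 - w i b)) := by
          rw [Finset.prod_univ_sum, Fintype.piFinset_univ]
      _ ≤ ∏ _i : Fin k, (2 * Real.cosh g) :=
          Finset.prod_le_prod (fun i _ => by positivity) fun i _ => hterm i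
      _ = _ := by simp
  have hcard : (Nat.card {s : Fin k → Bool // (∑ i, w i (s i) : ℝ) < 2 * ε * k} : ℝ) *
      Real.exp (g ^ 2 * k) ≤ ∑ s : Fin k → Bool, Real.exp (g * (k - ∑ i, (w i (s i) : ℝ))) := by
    rw [Nat.card_eq_fintype_card, Fintype.card_subtype, ← nsmul_eq_mul, ← Finset.sum_const]
    refine (Finset.sum_le_sum fun s hs => ?_).trans
      (Finset.sum_le_sum_of_subset_of_nonneg (Finset.subset_univ _) fun _ _ _ => by positivity)
    have hs' := (Finset.mem_filter.1 hs).2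
    refine Real.exp_le_exp.2 ?_
    have : g * k ≤ k - ∑ i, (w i (s i) : ℝ) := by rw [hg]; linarith
    nlinarith
  have hcosh : (2 * Real.cosh g) ^ k ≤ 2 ^ k * Real.exp (g ^ 2 / 2 * k) := by
    rw [mul_pow, mul_comm (g ^ 2 / 2) (k : ℝ), Real.exp_nat_mul]
    have := Real.cosh_le_exp_half_sq g
    have := (Real.cosh_pos g).le
    gcongr
  have hsplit : (2 : ℝ) ^ k * Real.exp (g ^ 2 / 2 * k) =
      2 ^ k * Real.exp (-(g ^ 2 / 2 * k)) * Real.exp (g ^ 2 * k) := by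
    rw [mul_assoc, ← Real.exp_add]
    ring_nf
  exact le_of_mul_le_mul_right
    ((hcard.trans (htotal.trans hcosh)).trans_eq hsplit) (Real.exp_pos _)

/-- If the two values of each weight add up to `2`, at most half of the choices have a total weight
below the average. -/
lemma two_mul_card_sum_lt_le {k : ℕ} (w : Fin k → Bool → ℕ) (hw : ∀ i, w i true + w i false = 2)
    (ε : ℝ) (hε : ε < 1 / 2) :
    2 * (Nat.card {s : Fin k → Bool // (∑ i, w i (s i) : ℝ) < 2 * ε * k} : ℝ) ≤ 2 ^ k := by
  classical
  -- Flipping all signs reflects the total weight about `k`, so the light choices are disjoint from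
  -- their flips.
  have hflip : ∀ s : Fin k → Bool,
      (∑ i, (w i (s i) : ℝ)) + ∑ i, (w i (!s i) : ℝ) = 2 * k := by
    intro s
    rw [← Finset.sum_add_distrib]
    have : ∀ i, (w i (s i) : ℝ) + w i (!s i) = 2 := by
      intro i
      have := hw i
      cases s i
      · rw [add_comm]; exact_mod_cast this
      · exact_mod_cast this
    simp [this, mul_comm]
  let G : Finset (Fin k → Bool) := Finset.univ.filter fun s => (∑ i, w i (s i) : ℝ) < 2 * ε * k
  let φ : (Fin k → Bool) → (Fin k → Bool) := fun s i => !s i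
  have hφ : Function.Injective φ := fun s t h => funext fun i => by
    simpa [φ] using congrFun h i
  have hdisj : Disjoint G (G.image φ) := by
    rw [Finset.disjoint_left]
    intro s hs hs'
    obtain ⟨u, hu, rfl⟩ := Finset.mem_image.1 hs'
    have h1 := (Finset.mem_filter.1 hs).2
    have h2 := (Finset.mem_filter.1 hu).2
    have h3 := hflip u
    have hk : (0 : ℝ) ≤ k := by positivity
    simp only [φ] at h1
    nlinarith
  have hle : G.card + G.card ≤ 2 ^ k := by
    have := Finset.card_le_univ (G ∪ G.image φ)
    rwa [Finset.card_union_of_disjoint hdisj, Finset.card_image_of_injective _ hφ,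
      Fintype.card_fun, Fintype.card_bool, Fintype.card_fin] at this
  have hG : Nat.card {s : Fin k → Bool // (∑ i, w i (s i) : ℝ) < 2 * ε * k} = G.card := by
    rw [Nat.card_eq_fintype_card, Fintype.card_subtype]
  rw [hG, two_mul]
  exact_mod_cast hle

/-! ### Target distributions on a shattered set of pairs -/

/-- The uniform distribution on the points `p i`. -/
noncomputable def uniformOn {X : Type*} [MeasurableSpace X] {k : ℕ} (p : Fin k → X) : Measure X :=
  (k : ℝ≥0∞)⁻¹ • ∑ i, Measure.dirac (p i)

lemma uniformOn_apply {X : Type*} [MeasurableSpace X] {k : ℕ} (p : Fin k → X) {A : Set X}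
    (hA : MeasurableSet A) [DecidablePred (· ∈ A)] :
    uniformOn p A = (k : ℝ≥0∞)⁻¹ * (∑ i, if p i ∈ A then 1 else 0 : ℕ) := by
  simp [uniformOn, hA, Set.indicator_apply]

lemma isProbabilityMeasure_uniformOn {X : Type*} [MeasurableSpace X] {k : ℕ} (hk : k ≠ 0)
    (p : Fin k → X) : IsProbabilityMeasure (uniformOn p) := by
  refine ⟨?_⟩
  simp [uniformOn, ENNReal.inv_mul_cancel, hk]

lemma measurableSet_eq_of_measurable {X : Type*} [MeasurableSpace X] {h : X → Bool}
    (hh : Measurable h) (b : Bool) : MeasurableSet {x | h x = b} :=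
  hh (MeasurableSet.singleton b)

/-- The points of the `k` pairs `a (i, false)`, `a (i, true)` that carry the label `b` if
`a (i, β)` is labelled `β` or `!β` according to the sign `s i`. -/
def labelled {X : Type*} {k : ℕ} (a : Fin k × Bool → X) (s : Fin k → Bool) (b : Bool) (i : Fin k) :
    X :=
  a (i, xor b (s i))

/-- The number of points of the pair `i` that `h` labels wrongly if the sign of the pair is `σ`. -/
def pairError {X : Type*} {k : ℕ} (a : Fin k × Bool → X) (h : X → Bool) (i : Fin k) (σ : Bool) :
    ℕ :=
  ∑ b : Bool, if h (a (i, xor b σ)) ≠ b then 1 else 0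

lemma pairError_add {X : Type*} {k : ℕ} (a : Fin k × Bool → X) (h : X → Bool) (i : Fin k) :
    pairError a h i true + pairError a h i false = 2 := by
  simp only [pairError, Fintype.sum_bool, Bool.xor_true, Bool.xor_false, Bool.not_true,
    Bool.not_false]
  cases h (a (i, true)) <;> cases h (a (i, false)) <;> simp

/-- A hypothesis whose two errors are small mislabels few points of the pairs. -/
lemma sum_pairError_lt {X : Type*} [MeasurableSpace X] {k : ℕ} (hk : k ≠ 0)
    (a : Fin k × Bool → X) (s : Fin k → Bool) {h : X → Bool} (hh : Measurable h) {ε : ℝ}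
    (hgood : ∀ b, uniformOn (labelled a s b) {x | h x ≠ b} < ENNReal.ofReal ε) :
    (∑ i, pairError a h i (s i) : ℝ) < 2 * ε * k := by
  classical
  have hk0 : (0 : ℝ) < k := by positivity
  have hb : ∀ b, ((∑ i, if h (a (i, xor b (s i))) ≠ b then 1 else 0 : ℕ) : ℝ) < ε * k := by
    intro b
    have := hgood b
    have hms : MeasurableSet {x | h x ≠ b} := (measurableSet_eq_of_measurable hh b).compl
    rw [uniformOn_apply _ hms] at this
    have hε : 0 < ε := ENNReal.ofReal_pos.1 (pos_of_gt this)
    rw [← ENNReal.ofReal_natCast, ← ENNReal.ofReal_natCast, ← ENNReal.ofReal_inv_of_pos hk0,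
      ← ENNReal.ofReal_mul (by positivity), ENNReal.ofReal_lt_ofReal_iff hε,
      inv_mul_lt_iff₀ hk0, mul_comm] at this
    exact this
  have hsum : (∑ i, pairError a h i (s i)) =
      ∑ b : Bool, ∑ i, if h (a (i, xor b (s i))) ≠ b then 1 else 0 := by
    simp only [pairError]
    exact Finset.sum_comm
  have h1 := hb true
  have h2 := hb false
  rw [← Nat.cast_sum, hsum, Fintype.sum_bool, Nat.cast_add]
  linarith

/-- A shattered set of at least `2 k` points contains `k` disjoint pairs, and all labellings of
these are realised. -/
lemma Shatters.exists_pairs {X : Type*} {H : Set (X → Bool)} {S : Finset X} (hS : Shatters H S)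
    {k : ℕ} (hk : 2 * k ≤ S.card) :
    ∃ a : Fin k × Bool → X, ∀ s : Fin k → Bool, ∃ f ∈ H, ∀ b i, f (labelled a s b i) = b := by
  classical
  have hcard : Fintype.card (Fin k × Bool) ≤ Fintype.card S := by
    simp only [Fintype.card_prod, Fintype.card_fin, Fintype.card_bool, Fintype.card_coe]
    omega
  obtain ⟨e⟩ := Function.Embedding.nonempty_of_card_le hcard
  have hinj : Function.Injective fun q => (e q : X) := Subtype.val_injective.comp e.injective
  refine ⟨fun q => e q, fun s => ?_⟩
  -- The point `(i, β)` gets the label `xor β (s i)`, which at `β = xor b (s i)` is `b`.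
  obtain ⟨f, hf, hfg⟩ := hS (Function.extend (fun q => (e q : X))
    (fun q => xor q.2 (s q.1)) fun _ => false)
  refine ⟨f, hf, fun b i => ?_⟩
  have := hfg (e (i, xor b (s i))) (e _).2
  rw [hinj.extend_apply (fun q => xor q.2 (s q.1))] at this
  simpa [labelled] using this

/-! ### Protocols -/

namespace Protocol

variable {X : Type*} {H : Set (X → Bool)}

lemma length_transcript (P : Protocol H) (c : P.Coins) (v : Machine → Fin P.m → Option X)
    (t : ℕ) : (P.transcript c v t).length = P.cost t := by
  induction t with
  | zero => simp [transcript, cost]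
  | succ t ih =>
    rw [transcript, List.length_append, ih, List.length_ofFn, cost, cost, Finset.sum_range_succ]

/-- The hypothesis announced by a machine without examples that has seen the bits `r`. -/
def blindOutput (P : Protocol H) (c : P.Coins) {n : ℕ} (r : Fin n → Bool) : X → Bool :=
  P.announce c (fun _ => none) (List.ofFn r)

/-- If all examples are held by the machine that does not announce the hypothesis, then only
the exchanged bits tell the announcing machine about the sample. -/
lemma exists_output_eq_blindOutput (P : Protocol H) (t : ℕ) (c : P.Coins) (x : Fin P.m → X) :
    ∃ r : Fin (P.cost t) → Bool,
      P.output t c (localData (fun _ => (P.speaker t).other) x) = P.blindOutput c r := by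
  have hne : (P.speaker t).other ≠ P.speaker t := by
    cases P.speaker t <;> simp [Machine.other]
  have hv : localData (fun _ => (P.speaker t).other) x (P.speaker t) = fun _ => none := by
    funext i
    simp [localData, hne]
  set v := localData (fun _ => (P.speaker t).other) x with hvdef
  refine ⟨fun i => (P.transcript c v t).get (i.cast (P.length_transcript c v t).symm), ?_⟩
  rw [output, blindOutput, hv]
  congr 2
  apply List.ext_get
  · simp [length_transcript]
  · intro n h1 h2
    simp

end Protocol

/-- The adversary that leaves every example as it is. -/
def Adversary.honest (X : Type*) [MeasurableSpace X] (m : ℕ) : Adversary X m where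
  -- The history `Set.Iic i` includes call `i`, so its clean example can be returned.
  choose i z := (z ⟨i, le_refl i⟩).2
  measurable_choose _ := (measurable_pi_apply _).snd

/-- The law of the flag of a call has total mass one. -/
lemma isProbabilityMeasure_flagLaw {lam : ℝ} (h0 : 0 ≤ lam) (h1 : lam ≤ 1) :
    IsProbabilityMeasure (flagLaw lam) := by
  refine ⟨?_⟩
  simp [flagLaw, ← ENNReal.ofReal_add (sub_nonneg.2 h1) h0]

/-! ### From counting targets to a lower bound on the cost -/

/-- The counting bound behind the theorem: if a hypothesis is good for at most `V` of the `2 ^ k`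
targets on `k` shattered pairs, then a protocol that learns has `(1 - δ) * 2 ^ k ≤ 2 ^ cost * V`. -/
lemma Protocol.Learns.mul_two_pow_le {X : Type*} [MeasurableSpace X] {H : Set (X → Bool)}
    (hH : ∀ h ∈ H, Measurable h) {P : Protocol H} {t : ℕ} {ε δ lam : ℝ}
    (hP : P.Learns t ε δ lam) (hδ : 0 ≤ δ) (h0 : 0 ≤ lam) (h1 : lam ≤ 1) {k : ℕ} (hk : k ≠ 0)
    {S : Finset X} (hS : Shatters H S) (hkS : 2 * k ≤ S.card) {V : ℝ}
    (hV : ∀ w : Fin k → Bool → ℕ, (∀ i, w i true + w i false = 2) →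
      (Nat.card {s : Fin k → Bool // (∑ i, w i (s i) : ℝ) < 2 * ε * k} : ℝ) ≤ V) :
    (1 - δ) * 2 ^ k ≤ 2 ^ P.cost t * V := by
  classical
  obtain ⟨a, ha⟩ := hS.exists_pairs hkS
  choose f hf hfa using ha
  have hV0 : 0 ≤ V := le_trans (by positivity) (hV (fun _ _ => 1) fun _ => rfl)
  have hmeas : ∀ c (r : Fin (P.cost t) → Bool), Measurable (P.blindOutput c r) :=
    fun c r => hH _ (P.announce c _ _).2
  let good (h : X → Bool) (s : Fin k → Bool) : Prop :=
    ∀ b, uniformOn (labelled a s b) {x | h x ≠ b} < ENNReal.ofReal ε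
  -- Coins for which no bit string helps fail on every sample, so the failure set contains the
  -- cylinder over `U s`.
  let U (s : Fin k → Bool) : Set P.Coins :=
    {c | ∀ r : Fin (P.cost t) → Bool, ¬ good (P.blindOutput c r) s}
  have hU : ∀ s, P.coinLaw (U s) ≤ ENNReal.ofReal δ := by
    intro s
    have hD : ∀ b, IsProbabilityMeasure (uniformOn (labelled a s b)) :=
      fun b => isProbabilityMeasure_uniformOn hk _
    have hsupp : ∀ b, uniformOn (labelled a s b) {x | f s x = b} = 1 := by
      intro b
      rw [uniformOn_apply _ (measurableSet_eq_of_measurable (hH _ (hf s)) b)]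
      simp [hfa, ENNReal.inv_mul_cancel, hk]
    have hlearn := hP (f s) (hf s) (fun b => uniformOn (labelled a s b)) hD hsupp
      (Adversary.honest X P.m) (fun _ => (P.speaker t).other)
    have := isProbabilityMeasure_flagLaw h0 h1
    have hcall : IsProbabilityMeasure
        (callLaw lam (fun b => uniformOn (labelled a s b)) P.oracle) := by
      unfold callLaw
      infer_instance
    calc P.coinLaw (U s) = (P.coinLaw.prod
          (callLaw lam (fun b => uniformOn (labelled a s b)) P.oracle)) (U s ×ˢ Set.univ) := by
          rw [Measure.prod_prod, measure_univ, mul_one]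
      _ ≤ _ := measure_mono ?_
      _ ≤ ENNReal.ofReal δ := hlearn
    rintro ⟨c, z⟩ ⟨hc, -⟩
    obtain ⟨r, hr⟩ := P.exists_output_eq_blindOutput t c ((Adversary.honest X P.m).sample z)
    simp only [Set.mem_ofPred_eq, hr]
    exact hc r
  have hcount : ∀ c, (Nat.card {s // c ∉ U s} : ℝ) ≤ 2 ^ P.cost t * V := by
    intro c
    let G (r : Fin (P.cost t) → Bool) : Finset (Fin k → Bool) :=
      Finset.univ.filter fun s => (∑ i, pairError a (P.blindOutput c r) i (s i) : ℝ) < 2 * ε * k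
    have hG : ∀ r, ((G r).card : ℝ) ≤ V := by
      intro r
      have := hV (pairError a (P.blindOutput c r)) (pairError_add a _)
      rwa [Nat.card_eq_fintype_card, Fintype.card_subtype] at this
    have hsub : (Finset.univ.filter fun s => c ∉ U s) ⊆ Finset.univ.biUnion G := by
      intro s hs
      have hs' := (Finset.mem_filter.1 hs).2
      simp only [U, Set.mem_ofPred_eq, not_forall, not_not] at hs'
      obtain ⟨r, hr⟩ := hs'
      exact Finset.mem_biUnion.2 ⟨r, Finset.mem_univ _, Finset.mem_filter.2
        ⟨Finset.mem_univ _, sum_pairError_lt hk a s (hmeas c r) hr⟩⟩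
    rw [Nat.card_eq_fintype_card, Fintype.card_subtype]
    calc ((Finset.univ.filter fun s => c ∉ U s).card : ℝ)
        ≤ ((Finset.univ.biUnion G).card : ℝ) := by exact_mod_cast Finset.card_le_card hsub
      _ ≤ ∑ r, ((G r).card : ℝ) := by exact_mod_cast Finset.card_biUnion_le
      _ ≤ ∑ _r : Fin (P.cost t) → Bool, V := Finset.sum_le_sum fun r _ => hG r
      _ = 2 ^ P.cost t * V := by simp
  have := card_mul_le_of_measure_le P.coinLaw U δ hδ _ (by positivity) hU hcount
  simpa using this

/-- Apart from an additive constant, the cost is at least linear in the number of pairs. -/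
lemma Protocol.Learns.le_cost {X : Type*} [MeasurableSpace X] {H : Set (X → Bool)}
    (hH : ∀ h ∈ H, Measurable h) {P : Protocol H} {t : ℕ} {ε δ lam : ℝ}
    (hP : P.Learns t ε δ lam) (hδ : 0 ≤ δ) (hδ' : δ < 1) (hε : ε < 1 / 2) (h0 : 0 ≤ lam)
    (h1 : lam ≤ 1) {k : ℕ} (hk : k ≠ 0) {S : Finset X} (hS : Shatters H S)
    (hkS : 2 * k ≤ S.card) :
    (1 - 2 * ε) ^ 2 / 2 * k + Real.log (1 - δ) ≤ P.cost t := by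
  have h := hP.mul_two_pow_le hH hδ h0 h1 hk hS hkS fun w hw => card_sum_lt_le w hw ε hε
  have h2 : (1 - δ) ≤ 2 ^ P.cost t * Real.exp (-((1 - 2 * ε) ^ 2 / 2 * k)) := by
    refine le_of_mul_le_mul_right (h.trans_eq ?_) (by positivity : (0 : ℝ) < 2 ^ k)
    ring
  have h3 := Real.log_le_log (by linarith) h2
  rw [Real.log_mul (by positivity) (by positivity), Real.log_exp, Real.log_pow] at h3
  have h4 : (P.cost t : ℝ) * Real.log 2 ≤ P.cost t :=
    mul_le_of_le_one_right (by positivity) (by linarith [Real.log_two_lt_d9])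
  linarith

/-- A protocol that fails with probability less than `1 / 2` has to exchange some bit. -/
lemma Protocol.Learns.one_le_cost {X : Type*} [MeasurableSpace X] {H : Set (X → Bool)}
    (hH : ∀ h ∈ H, Measurable h) {P : Protocol H} {t : ℕ} {ε δ lam : ℝ}
    (hP : P.Learns t ε δ lam) (hδ : 0 ≤ δ) (hδ' : δ < 1 / 2) (hε : ε < 1 / 2) (h0 : 0 ≤ lam)
    (h1 : lam ≤ 1) {S : Finset X} (hS : Shatters H S) (hcard : 2 ≤ S.card) :
    1 ≤ P.cost t := by
  by_contra hlt
  have hcost : P.cost t = 0 := by omega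
  -- For one pair, at most one of the two signs suits a given hypothesis; at cost zero this would
  -- force `2 * (1 - δ) ≤ 1`.
  have h := hP.mul_two_pow_le hH hδ h0 h1 one_ne_zero hS (by omega) (V := 1) fun w hw => by
    have := two_mul_card_sum_lt_le w hw ε hε
    linarith
  rw [hcost] at h
  norm_num at h
  linarith

/-- The cost of learning is at least linear in the size of a shattered set. -/
theorem exists_mul_card_le_cost (ε₀ δ : ℝ) (hε₀ : ε₀ < 1 / 2) (hδ : 0 < δ) (hδ' : δ < 1) :
    ∃ c : ℝ, 0 < c ∧ ∃ d₀ : ℕ, 0 < d₀ ∧ (δ < 1 / 2 → d₀ ≤ 2) ∧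
      ∀ (X : Type*) [MeasurableSpace X] (H : Set (X → Bool)), (∀ h ∈ H, Measurable h) →
        ∀ ε lam : ℝ, 0 ≤ lam → lam < ε → ε ≤ ε₀ → ∀ (t : ℕ) (P : Protocol H),
          P.Learns t ε δ lam → ∀ S : Finset X, Shatters H S → d₀ ≤ S.card →
            c * S.card ≤ P.cost t := by
  -- Half of the slope in `Protocol.Learns.le_cost`; the other half absorbs `Real.log (1 - δ)` once
  -- `k ≥ k₀`.
  set γ : ℝ := (1 - 2 * ε₀) ^ 2 / 4 with hγ
  have hg : 0 < 1 - 2 * ε₀ := by linarith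
  have hγ0 : 0 < γ := by positivity
  obtain ⟨k₀, hk₀⟩ := exists_nat_ge (-Real.log (1 - δ) / γ)
  -- The `3` pays for rounding in `S.card / 2`; `1 / (k₀ + 1)` lets a single bit suffice when `k ≤
  -- k₀`, a case that occurs only for `δ < 1 / 2`.
  refine ⟨min γ (1 / (k₀ + 1)) / 3, by positivity, if δ < 1 / 2 then 2 else 2 * (k₀ + 1),
    by split_ifs <;> omega, fun h => (if_pos h).le, ?_⟩
  intro X _ H hH ε lam h0 hlam hε t P hP S hS hd
  have hd2 : 2 ≤ S.card := by split_ifs at hd <;> omega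
  obtain ⟨k, hk⟩ : ∃ k, k = S.card / 2 := ⟨_, rfl⟩
  have hk1 : 1 ≤ k := by omega
  have hcard : (S.card : ℝ) ≤ 3 * k := by
    have : S.card ≤ 3 * k := by omega
    exact_mod_cast this
  have hmin : 0 < min γ (1 / ((k₀ : ℝ) + 1)) := by positivity
  suffices h : min γ (1 / ((k₀ : ℝ) + 1)) * k ≤ P.cost t by nlinarith
  by_cases hbig : k₀ + 1 ≤ k
  · have h := hP.le_cost hH hδ.le hδ' (by linarith) h0 (by linarith) (by omega) hS
      (k := k) (by omega)
    have hlog : -Real.log (1 - δ) ≤ γ * k := by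
      rw [div_le_iff₀ hγ0] at hk₀
      have : (k₀ : ℝ) + 1 ≤ k := by exact_mod_cast hbig
      nlinarith
    have hsq : (1 - 2 * ε₀) ^ 2 ≤ (1 - 2 * ε) ^ 2 := by
      gcongr
    have hk0 : (0 : ℝ) ≤ k := by positivity
    have hγk : 2 * γ * k ≤ (1 - 2 * ε) ^ 2 / 2 * k := by
      gcongr
      rw [hγ]
      linarith
    have := mul_le_mul_of_nonneg_right (min_le_left γ (1 / ((k₀ : ℝ) + 1))) hk0
    linarith
  · have hδ2 : δ < 1 / 2 := by
      by_contra hge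
      rw [if_neg hge] at hd
      omega
    have h : (1 : ℝ) ≤ P.cost t := by
      exact_mod_cast hP.one_le_cost hH hδ.le hδ2 (by linarith) h0 (by linarith) hS hd2
    have hkle : (k : ℝ) ≤ k₀ + 1 := by
      have : k ≤ k₀ + 1 := by omega
      exact_mod_cast this
    calc min γ (1 / ((k₀ : ℝ) + 1)) * k ≤ 1 / ((k₀ : ℝ) + 1) * (k₀ + 1) := by
          gcongr
          exact min_le_right _ _
      _ = 1 := by field_simp
      _ ≤ P.cost t := h

end RobustLearning

/-! ### Passage to the VC-dimension and the communication complexity -/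

theorem theorem2 (ε₀ δ : ℝ) (hε₀ : ε₀ < 1 / 2) (hδ : 0 < δ) (hδ' : δ < 1) :
    ∃ c : ℝ, 0 < c ∧ ∃ d₀ : ℕ, (δ < 1 / 2 → d₀ ≤ 2) ∧
      ∀ (X : Type*) [MeasurableSpace X] (H : Set (X → Bool)),
        (∀ h ∈ H, Measurable h) → (d₀ : ℕ∞) ≤ RobustLearning.vcDim H →
        ∀ ε lam : ℝ, 0 ≤ lam → lam < ε → ε ≤ ε₀ → ∀ t : ℕ, 1 ≤ t →
          ENNReal.ofReal (c * ((1 - ε) / (1 - lam)) / (t : ℝ) ^ 2) *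
              (RobustLearning.vcDim H : ENNReal)
            ≤ (RobustLearning.commComplexity H t ε δ lam : ENNReal) := by

  obtain ⟨c, hc, d₀, hd₀, hd₀', hmain⟩ :=
    RobustLearning.exists_mul_card_le_cost ε₀ δ hε₀ hδ hδ'
  refine ⟨c, hc, d₀, hd₀', ?_⟩
  intro X _ H hH hd ε lam h0 hlam hε t ht
  obtain ⟨S₀, hS₀, hS₀d⟩ : ∃ S₀ : Finset X, RobustLearning.Shatters H S₀ ∧ d₀ ≤ S₀.card := by
    -- As `d₀` is positive, `d₀ - 1` lies strictly below the supremum, so some shattered set exceeds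
    -- it, even if the dimension is infinite.
    have hlt : ((d₀ - 1 : ℕ) : ℕ∞) < RobustLearning.vcDim H :=
      lt_of_lt_of_le (by exact_mod_cast Nat.sub_lt hd₀ one_pos) hd
    simp only [RobustLearning.vcDim, lt_iSup_iff] at hlt
    obtain ⟨S₀, hS₀, h⟩ := hlt
    have h' : d₀ - 1 < S₀.card := by exact_mod_cast h
    exact ⟨S₀, hS₀, by omega⟩
  have ht1 : (1 : ℝ) ≤ (t : ℝ) ^ 2 := one_le_pow₀ (by exact_mod_cast ht)
  have hratio : (1 - ε) / (1 - lam) ≤ 1 := (div_le_one (by linarith)).2 (by linarith)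
  have hcoef : c * ((1 - ε) / (1 - lam)) / (t : ℝ) ^ 2 ≤ c := by
    rw [div_le_iff₀ (by positivity)]
    nlinarith
  have hcost : ∀ P : RobustLearning.Protocol H, P.Learns t ε δ lam →
      ENNReal.ofReal c * (RobustLearning.vcDim H : ENNReal) ≤ (P.cost t : ENNReal) := by
    intro P hP
    have hS : ∀ S : Finset X, RobustLearning.Shatters H S →
        ENNReal.ofReal c * (S.card : ENNReal) ≤ (P.cost t : ENNReal) := by
      intro S hS
      rw [← ENNReal.ofReal_natCast, ← ENNReal.ofReal_natCast, ← ENNReal.ofReal_mul hc.le]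
      refine ENNReal.ofReal_le_ofReal ?_
      -- Shattered sets too small for the bound are dominated by `S₀`.
      rcases le_total d₀ S.card with hle | hle
      · exact hmain X H hH ε lam h0 hlam hε t P hP S hS hle
      · refine le_trans ?_ (hmain X H hH ε lam h0 hlam hε t P hP S₀ hS₀ hS₀d)
        have : (S.card : ℝ) ≤ S₀.card := by exact_mod_cast hle.trans hS₀d
        gcongr
    simp only [RobustLearning.vcDim, ENat.toENNReal_iSup, ENNReal.mul_iSup, iSup_le_iff]
    exact fun S h => by simpa using hS S h
  refine (mul_le_mul_left (ENNReal.ofReal_le_ofReal hcoef) _).trans ?_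
  simp only [RobustLearning.commComplexity, ENat.toENNReal_iInf, le_iInf_iff]
  exact fun P hP => by simpa using hcost P hP
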